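/- **Setting.** Let $\mathfrak g=\mathfrak k\oplus\mathfrak p$ be a finite-dimensional real vector space with a fixed decomposition, $r\neq s$ non-negative integers, and $T$ the space of tensors of type $(r,s)$ on $\mathfrak p$ (multilinear maps $\mathfrak p^r\to\mathfrak p^{\otimes s}$) or of $m$-tuples of such tensors. $\mathrm{GL}(\mathfrak p)$ acts on $T$ by $h\cdot\gamma=h\cdot\gamma(h^{-1}\cdot,\dots,h^{-1}\cdot)$, with derived representation $\theta$ of $\mathfrak{gl}(\mathfrak p)$, so $\theta(A)\gamma=A\cdot\gamma(\cdot,\dots,\cdot)-\gamma(A\cdot,\dots,\cdot)-\dots-\gamma(\cdot,\dots,A\cdot)$; likewise $g\cdot\mu=g\mu(g^{-1}\cdot,g^{-1}\cdot)$ and $\theta(E)\mu=E\mu(\cdot,\cdot)-\mu(E\cdot,\cdot)-\mu(\cdot,E\cdot)$ for bilinear $\mu:\mathfrak g\times\mathfrak g\to\mathfrak g$. A pair $(\mu,\gamma)$ represents the homogeneous space $(G_\mu/K_\mu,\gamma)$ with an invariant geometric structure if $\mu$ is a Lie bracket, $\gamma\in T$, and: $\mu(\mathfrak k,\mathfrak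 k)\subset\mathfrak k$, $\mu(\mathfrak k,\mathfrak p)\subset\mathfrak p$; $K_\mu$ is closed in $G_\mu$, where $G_\mu$ is the simply connected Lie group with Lie algebra $(\mathfrak g,\mu)$ and $K_\mu$ its connected Lie subgroup with Lie algebra $\mathfrak k$; $\{Z\in\mathfrak k:\mu(Z,\mathfrak p)=0\}=0$; and $\theta(\mathrm{ad}_\mu Z|_{\mathfrak p})\gamma=0$ for all $Z\in\mathfrak k$. Let $\Gamma$ be a set of such pairs, closed under $(\mu,\gamma)\mapsto(\bar h\cdot\mu,h\cdot\gamma)$ for $\bar h=\mathrm{diag}(a,h)\in \mathrm{GL}(\mathfrak k)\times \mathrm{GL}(\mathfrak p)$ and under $(\mu,\gamma)\mapsto(\mu,x\gamma)$ for $x>0$, with a preferred direction $q(\mu,\gamma)\in\theta(\mathfrak{gl}(\mathfrak p))\gamma$ on $\Gamma$ that satisfies $q(\bar h\cdot\mu,h\cdot\gamma)=h\cdot q(\mu,\gamma)$ and $q(\mu,x\gamma)=x^\alpha q(\mu,\gamma)$ for $x>0$, where $\alpha<1$ is fixed, and that is locally Lipschitz in $\gamma$ for each fixed $\mu$. Fix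 $\gamma\in T$ and a decomposition $\mathfrak{gl}(\mathfrak p)=\mathfrak{gl}(\mathfrak p)_\gamma\oplus\mathfrak q_\gamma$, where $\mathfrak{gl}(\mathfrak p)_\gamma=\{A:\theta(A)\gamma=0\}$ and $\mathfrak q_\gamma$ is a subspace which contains $I$ and is invariant under conjugation by the stabilizer $\mathrm{GL}(\mathfrak p)_\gamma$. For $(\mu,\gamma)\in\Gamma$ let $Q_\mu\in\mathfrak q_\gamma$ be the unique operator with $\theta(Q_\mu)\gamma=q(\mu,\gamma)$. A bracket flow solution on an open interval $J$ is a differentiable curve $\mu(t)$, $t\in J$, with $(\mu(t),\gamma)\in\Gamma$, $Q_{\mu(t)}$ continuous in $t$, and $$\tfrac{d}{dt}\mu(t)=-\theta\left(\begin{bmatrix}0&0\\0&Q_{\mu(t)}\end{bmatrix}\right)\mu(t).$$ For $x\in\mathbb R^*$ put $x\cdot\mu:=\mathrm{diag}(I,x^{-1}I)\cdot\mu$. **Proposition.** Let $(\mu,\gamma)\in\Gamma$ be a semi-algebraic soliton: $q(\mu,\gamma)=c\gamma+\theta(D_{\mathfrak p})\gamma$, where $c\in\mathbb R$ and $D$ is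 a derivation of $(\mathfrak g,\mu)$ with $D\mathfrak k\subset\mathfrak k$ and $\mathfrak p$-block $D_{\mathfrak p}$. Assume that $D=\mathrm{diag}(0,D_{\mathfrak p})$. Let $A$ be the projection of $D_{\mathfrak p}$ onto $\mathfrak{gl}(\mathfrak p)_\gamma$ along $\mathfrak q_\gamma$ and put $$c(t)=\big((1-\alpha)ct+1\big)^{\frac1{1-\alpha}},\qquad s(t)=\frac{\log((1-\alpha)ct+1)}{(1-\alpha)c}\quad(s(t)=t\text{ if }c=0).$$ Then the bracket flow solution starting at $\mu$ is $$\mu(t)=c(t)^{\frac1{s-r}}\cdot\left(\begin{bmatrix}I&0\\0&e^{s(t)A}\end{bmatrix}\cdot\mu\right).$$ That is, this curve is a bracket flow solution on $I_c=\{t:(1-\alpha)ct+1>0\}$ with $\mu(0)=\mu$, and every bracket flow solution starting at $\mu$ on an open interval $J\ni0$ coincides with it on $J\cap I_c$. -/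

import Mathlib

open scoped Manifold ContDiff

/-! Homogeneous geometric structures on `G/K`, encoded by a Lie bracket on `𝔤 = 𝔨 ⊕ 𝔭` and a tensor
on `𝔭`; geometric flows of such structures and the associated bracket flow.  All vector spaces are
finite dimensional in the final theorem, the norms only fix the topology, and `𝔤𝔩(V)` is
`V →L[ℝ] V`. -/

namespace HomFlow

noncomputable section

section Tensors

variable {p : Type*} [NormedAddCommGroup p] [NormedSpace ℝ p]

/-- The `s`-fold tensor power `p ⊗ ⋯ ⊗ p` of a finite-dimensional space `p`, viewed as the space of
`s`-linear forms on the dual of `p`. -/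
def TensorPow (s : ℕ) (p : Type*) [NormedAddCommGroup p] [NormedSpace ℝ p] : Type _ :=
  ContinuousMultilinearMap ℝ (fun _ : Fin s => (p →L[ℝ] ℝ)) ℝ

instance (s : ℕ) : NormedAddCommGroup (TensorPow s p) :=
  inferInstanceAs (NormedAddCommGroup
    (ContinuousMultilinearMap ℝ (fun _ : Fin s => (p →L[ℝ] ℝ)) ℝ))

instance (s : ℕ) : NormedSpace ℝ (TensorPow s p) :=
  inferInstanceAs (NormedSpace ℝ
    (ContinuousMultilinearMap ℝ (fun _ : Fin s => (p →L[ℝ] ℝ)) ℝ))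

/-- The value of `w ∈ p ⊗ ⋯ ⊗ p` on covectors `ξ₁, …, ξₛ`, as a linear function of `w`. -/
def TensorPow.eval {s : ℕ} (ξ : Fin s → (p →L[ℝ] ℝ)) : TensorPow s p →ₗ[ℝ] ℝ where
  toFun w := (show ContinuousMultilinearMap ℝ (fun _ : Fin s => (p →L[ℝ] ℝ)) ℝ from w) ξ
  map_add' _ _ := rfl
  map_smul' _ _ := rfl

theorem TensorPow.ext {s : ℕ} {w w' : TensorPow s p}
    (h : ∀ ξ, TensorPow.eval ξ w = TensorPow.eval ξ w') : w = w' :=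
  ContinuousMultilinearMap.ext h

/-- The linear map `C₁ ⊗ ⋯ ⊗ Cₛ` of `p ⊗ ⋯ ⊗ p`. -/
def TensorPow.map {s : ℕ} (C : Fin s → (p →L[ℝ] p)) : TensorPow s p →L[ℝ] TensorPow s p :=
  ContinuousMultilinearMap.compContinuousLinearMapL
    (fun j => (ContinuousLinearMap.compL ℝ p p ℝ).flip (C j))

@[simp] theorem TensorPow.eval_map {s : ℕ} (C : Fin s → (p →L[ℝ] p)) (w : TensorPow s p)
    (ξ : Fin s → (p →L[ℝ] ℝ)) :
    TensorPow.eval ξ (TensorPow.map C w) = TensorPow.eval (fun j => (ξ j).comp (C j)) w := rfl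

/-- Tensors of type `(r, s)` on `p`: multilinear maps `p × ⋯ × p → p ⊗ ⋯ ⊗ p` (`r` arguments, `s`
tensor factors). -/
abbrev Tensor (r s : ℕ) (p : Type*) [NormedAddCommGroup p] [NormedSpace ℝ p] : Type _ :=
  ContinuousMultilinearMap ℝ (fun _ : Fin r => p) (TensorPow s p)

/-- `m`-tuples of tensors of type `(r, s)` on `p`. -/
abbrev Tensors (m r s : ℕ) (p : Type*) [NormedAddCommGroup p] [NormedSpace ℝ p] : Type _ :=
  Fin m → Tensor r s p

/-- `(v₁, …, vᵣ) ↦ (C₁ ⊗ ⋯ ⊗ Cₛ) γ(B₁ v₁, …, Bᵣ vᵣ)`. -/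
def Tensor.comp {r s : ℕ} (γ : Tensor r s p) (B : Fin r → (p →L[ℝ] p))
    (C : Fin s → (p →L[ℝ] p)) : Tensor r s p :=
  (TensorPow.map C).compContinuousMultilinearMap (γ.compContinuousLinearMap B)

@[simp] theorem Tensor.comp_apply {r s : ℕ} (γ : Tensor r s p) (B : Fin r → (p →L[ℝ] p))
    (C : Fin s → (p →L[ℝ] p)) (v : Fin r → p) :
    γ.comp B C v = TensorPow.map C (γ (fun i => B i (v i))) := rfl

/-- The left action `h · γ = h ·ₛ γ(h⁻¹ ·, …, h⁻¹ ·)` of `GL(p)` on (tuples of) tensors. -/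
def tensorAct {m r s : ℕ} (h : (p →L[ℝ] p)ˣ) (γ : Tensors m r s p) : Tensors m r s p :=
  fun i => (γ i).comp (fun _ => ((h⁻¹ : (p →L[ℝ] p)ˣ) : p →L[ℝ] p)) (fun _ => (h : p →L[ℝ] p))

/-- The representation `θ(A)γ = θₛ(A)γ - γ(A ·, …, ·) - ⋯ - γ(·, …, A ·)` of `𝔤𝔩(p)`. -/
def tensorRep {m r s : ℕ} (A : p →L[ℝ] p) (γ : Tensors m r s p) : Tensors m r s p :=
  fun i => (∑ j : Fin s, (γ i).comp 1 (Function.update 1 j A))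
    - ∑ l : Fin r, (γ i).comp (Function.update 1 l A) 1

theorem tensorRep_apply {m r s : ℕ} (A : p →L[ℝ] p) (γ : Tensors m r s p) (i : Fin m)
    (v : Fin r → p) (ξ : Fin s → (p →L[ℝ] ℝ)) :
    TensorPow.eval ξ (tensorRep A γ i v)
      = (∑ j : Fin s, TensorPow.eval (Function.update ξ j ((ξ j).comp A)) (γ i v))
        - ∑ l : Fin r, TensorPow.eval ξ (γ i (Function.update v l (A (v l)))) := by
  have h1 : ∀ j : Fin s, (fun j' => (ξ j').comp ((Function.update 1 j A : Fin s → (p →L[ℝ] p)) j'))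
      = Function.update ξ j ((ξ j).comp A) := by
    intro j; funext j'
    by_cases h : j' = j
    · subst h; simp
    · simp only [Function.update_of_ne h, Pi.one_apply]; rfl
  have h2 : ∀ l : Fin r, (fun l' => (Function.update 1 l A : Fin r → (p →L[ℝ] p)) l' (v l'))
      = Function.update v l (A (v l)) := by
    intro l; funext l'
    by_cases h : l' = l
    · subst h; simp
    · simp [Function.update_of_ne h]
  have h3 : (fun j => (ξ j).comp ((1 : Fin s → (p →L[ℝ] p)) j)) = ξ := by funext j; rfl
  have h4 : (fun l => (1 : Fin r → (p →L[ℝ] p)) l (v l)) = v := by funext l; rfl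
  simp only [tensorRep, sub_apply, sum_apply, Tensor.comp_apply, map_sub, map_sum,
    TensorPow.eval_map, h1, h2, h3, h4]

theorem TensorPow.eval_update_add {s : ℕ} (w : TensorPow s p) (ξ : Fin s → (p →L[ℝ] ℝ)) (j : Fin s)
    (x y : p →L[ℝ] ℝ) : TensorPow.eval (Function.update ξ j (x + y)) w
      = TensorPow.eval (Function.update ξ j x) w + TensorPow.eval (Function.update ξ j y) w :=
  ContinuousMultilinearMap.map_update_add _ ξ j x y

theorem TensorPow.eval_update_smul {s : ℕ} (w : TensorPow s p) (ξ : Fin s → (p →L[ℝ] ℝ))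
    (j : Fin s) (a : ℝ) (x : p →L[ℝ] ℝ) : TensorPow.eval (Function.update ξ j (a • x)) w
      = a • TensorPow.eval (Function.update ξ j x) w :=
  ContinuousMultilinearMap.map_update_smul _ ξ j a x

theorem tensorRep_add {m r s : ℕ} (A B : p →L[ℝ] p) (γ : Tensors m r s p) :
    tensorRep (A + B) γ = tensorRep A γ + tensorRep B γ := by
  refine funext fun i => ContinuousMultilinearMap.ext fun v => TensorPow.ext fun ξ => ?_
  simp only [Pi.add_apply, add_apply, map_add, tensorRep_apply, ContinuousLinearMap.comp_add,
    ContinuousMultilinearMap.map_update_add, TensorPow.eval_update_add, Finset.sum_add_distrib]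
  ring

theorem tensorRep_smul {m r s : ℕ} (a : ℝ) (A : p →L[ℝ] p) (γ : Tensors m r s p) :
    tensorRep (a • A) γ = a • tensorRep A γ := by
  refine funext fun i => ContinuousMultilinearMap.ext fun v => TensorPow.ext fun ξ => ?_
  simp only [Pi.smul_apply, smul_apply, map_smul, tensorRep_apply, ContinuousLinearMap.comp_smul,
    ContinuousMultilinearMap.map_update_smul, TensorPow.eval_update_smul, ← Finset.smul_sum,
    smul_sub]

/-- The stabilizer algebra `𝔤𝔩(p)_γ = {A : θ(A)γ = 0}`. -/
def stabilizerAlgebra {m r s : ℕ} (γ : Tensors m r s p) : Submodule ℝ (p →L[ℝ] p) where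
  carrier := {A | tensorRep A γ = 0}
  zero_mem' := by
    have h := tensorRep_smul 0 0 γ
    rwa [zero_smul, zero_smul] at h
  add_mem' {A B} hA hB := by
    change tensorRep (A + B) γ = 0
    rw [tensorRep_add, hA, hB, add_zero]
  smul_mem' a A hA := by
    change tensorRep (a • A) γ = 0
    rw [tensorRep_smul, hA, smul_zero]

/-- `𝔮` is a complement of `𝔤𝔩(p)_γ` in `𝔤𝔩(p)` which is invariant under conjugation by the
stabilizer group `GL(p)_γ`. -/
structure IsInvariantComplement {m r s : ℕ} (γ : Tensors m r s p)
    (𝔮 : Submodule ℝ (p →L[ℝ] p)) : Prop where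
  isCompl : IsCompl (stabilizerAlgebra γ) 𝔮
  conj_mem : ∀ h : (p →L[ℝ] p)ˣ, tensorAct h γ = γ → ∀ B ∈ 𝔮,
    (h : p →L[ℝ] p) * B * ((h⁻¹ : (p →L[ℝ] p)ˣ) : p →L[ℝ] p) ∈ 𝔮

/-- `e^A` as an element of `GL(p)`. -/
def expUnit [FiniteDimensional ℝ p] (A : p →L[ℝ] p) : (p →L[ℝ] p)ˣ :=
  haveI : CompleteSpace p := FiniteDimensional.complete ℝ p
  letI : NormedAlgebra ℚ (p →L[ℝ] p) := .restrictScalars ℚ ℝ _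
  { val := NormedSpace.exp A
    inv := NormedSpace.exp (-A)
    val_inv := by
      rw [← NormedSpace.exp_add_of_commute (Commute.neg_right (Commute.refl A)), add_neg_cancel,
        NormedSpace.exp_zero]
    inv_val := by
      rw [← NormedSpace.exp_add_of_commute (Commute.neg_left (Commute.refl A)), neg_add_cancel,
        NormedSpace.exp_zero] }

end Tensors

section Brackets

variable {k p : Type*} [NormedAddCommGroup k] [NormedSpace ℝ k]
  [NormedAddCommGroup p] [NormedSpace ℝ p]

/-- Bilinear maps `𝔤 × 𝔤 → 𝔤`, where `𝔤 = k ⊕ p`. -/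
abbrev Bilin (k p : Type*) [NormedAddCommGroup k] [NormedSpace ℝ k]
    [NormedAddCommGroup p] [NormedSpace ℝ p] : Type _ :=
  (k × p) →L[ℝ] (k × p) →L[ℝ] (k × p)

/-- `(g, g') ↦ g μ(g' ·, g' ·)`. -/
def Bilin.conj (g g' : (k × p) →L[ℝ] (k × p)) (μ : Bilin k p) : Bilin k p :=
  (ContinuousLinearMap.compL ℝ (k × p) (k × p) (k × p) g).comp (μ.bilinearComp g' g')

@[simp] theorem Bilin.conj_apply (g g' : (k × p) →L[ℝ] (k × p)) (μ : Bilin k p) (X Y : k × p) :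
    Bilin.conj g g' μ X Y = g (μ (g' X) (g' Y)) := rfl

/-- The action of the block diagonal `diag(a, h) ∈ GL(k) × GL(p)` on brackets,
`g · μ = g μ(g⁻¹ ·, g⁻¹ ·)`. -/
def bracketAct (a : (k →L[ℝ] k)ˣ) (h : (p →L[ℝ] p)ˣ) (μ : Bilin k p) : Bilin k p :=
  Bilin.conj ((a : k →L[ℝ] k).prodMap (h : p →L[ℝ] p))
    (((a⁻¹ : (k →L[ℝ] k)ˣ) : k →L[ℝ] k).prodMap ((h⁻¹ : (p →L[ℝ] p)ˣ) : p →L[ℝ] p)) μ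

/-- The scaling `c · μ = diag(I, c⁻¹ I) · μ`, for `c ≠ 0`. -/
def bracketScale (c : ℝ) (μ : Bilin k p) : Bilin k p :=
  Bilin.conj ((1 : k →L[ℝ] k).prodMap (c⁻¹ • (1 : p →L[ℝ] p)))
    ((1 : k →L[ℝ] k).prodMap (c • (1 : p →L[ℝ] p))) μ

/-- The representation `θ(E)μ = E μ(·, ·) - μ(E ·, ·) - μ(·, E ·)` of `𝔤𝔩(𝔤)` on brackets. -/
def bracketRep (E : (k × p) →L[ℝ] (k × p)) (μ : Bilin k p) : Bilin k p :=
  (ContinuousLinearMap.compL ℝ (k × p) (k × p) (k × p) E).comp μ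
    - μ.bilinearComp E (ContinuousLinearMap.id ℝ (k × p))
    - μ.bilinearComp (ContinuousLinearMap.id ℝ (k × p)) E

@[simp] theorem bracketRep_apply (E : (k × p) →L[ℝ] (k × p)) (μ : Bilin k p) (X Y : k × p) :
    bracketRep E μ X Y = E (μ X Y) - μ (E X) Y - μ X (E Y) := rfl

/-- The `p`-block of an endomorphism of `k ⊕ p`. -/
def pBlock (E : (k × p) →L[ℝ] (k × p)) : p →L[ℝ] p :=
  (ContinuousLinearMap.snd ℝ k p).comp (E.comp (ContinuousLinearMap.inr ℝ k p))

/-- The block diagonal endomorphism `diag(0, B)` of `k ⊕ p`. -/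
def diagP (k : Type*) [NormedAddCommGroup k] [NormedSpace ℝ k] (B : p →L[ℝ] p) :
    (k × p) →L[ℝ] (k × p) :=
  (0 : k →L[ℝ] k).prodMap B

/-- `μ` is a Lie bracket. -/
structure IsLieBracket (μ : Bilin k p) : Prop where
  self : ∀ X, μ X X = 0
  jacobi : ∀ X Y Z, μ X (μ Y Z) + μ Y (μ Z X) + μ Z (μ X Y) = 0

/-- `D ∈ Der(𝔤/𝔨)`: a derivation of `(𝔤, μ)` with `D 𝔨 ⊆ 𝔨`. -/
structure IsDerivation (μ : Bilin k p) (D : (k × p) →L[ℝ] (k × p)) : Prop where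
  leibniz : ∀ X Y, D (μ X Y) = μ (D X) Y + μ X (D Y)
  map_k : ∀ Z : k, (D (Z, 0)).2 = 0

/-- `f` is a smooth one-parameter subgroup of the Lie group `G` with initial velocity `X`. -/
def IsOneParameterSubgroup {E G : Type*} [NormedAddCommGroup E] [NormedSpace ℝ E]
    [TopologicalSpace G] [ChartedSpace E G] [Group G]
    (X : GroupLieAlgebra 𝓘(ℝ, E) G) (f : ℝ → G) : Prop :=
  ContMDiff 𝓘(ℝ, ℝ) 𝓘(ℝ, E) ∞ f ∧ (∀ t u, f (t + u) = f t * f u) ∧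
    (mfderiv 𝓘(ℝ, ℝ) 𝓘(ℝ, E) f 0 (1 : ℝ) : E) = X

/-- `K_μ` is closed in `G_μ`: here `G_μ` is the simply connected Lie group with Lie algebra
`(𝔤, μ)`, and `K_μ`, its connected Lie subgroup with Lie algebra `𝔨`, is the subgroup generated by
the exponentials of the elements of `𝔨`. -/
def IsotropyClosed (μ : Bilin k p) : Prop :=
  ∃ (G : Type) (_ : TopologicalSpace G) (_ : ChartedSpace (k × p) G) (_ : Group G)
    (_ : LieGroup 𝓘(ℝ, k × p) ∞ G) (_ : T2Space G) (_ : SimplyConnectedSpace G)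
    (φ : (k × p) ≃ₗ[ℝ] GroupLieAlgebra 𝓘(ℝ, k × p) G),
    (∀ X Y, φ (μ X Y) = ⁅φ X, φ Y⁆) ∧
    IsClosed (Subgroup.closure
      {x : G | ∃ (Z : k) (f : ℝ → G), IsOneParameterSubgroup (φ (Z, 0)) f ∧ f 1 = x} : Set G)

/-- `(G_μ/K_μ, γ)` is a simply connected, almost effective homogeneous space endowed with the
invariant geometric structure `γ`, with reductive decomposition `𝔤 = 𝔨 ⊕ 𝔭`. -/
structure IsHomogeneous {m r s : ℕ} (μ : Bilin k p) (γ : Tensors m r s p) : Prop where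
  isLieBracket : IsLieBracket μ
  map_kk : ∀ Z W : k, (μ (Z, 0) (W, 0)).2 = 0
  map_kp : ∀ (Z : k) (X : p), (μ (Z, 0) (0, X)).1 = 0
  isotropyClosed : IsotropyClosed μ
  almostEffective : ∀ Z : k, (∀ X : p, μ (Z, 0) (0, X) = 0) → Z = 0
  invariant : ∀ Z : k, tensorRep (pBlock (μ (Z, 0))) γ = 0

/-- A space `Γ` of homogeneous geometric structures together with a preferred direction `q`.
`(μ, γ) ∈ Γ` stands for `(G_μ/K_μ, γ)`, and `q μ γ` is the value at the origin of the invariant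
tensor field `q(γ)` on `G_μ/K_μ`. -/
structure PreferredDirection (k p : Type*) [NormedAddCommGroup k] [NormedSpace ℝ k]
    [NormedAddCommGroup p] [NormedSpace ℝ p] (m r s : ℕ) where
  /-- the space of structures -/
  Γ : Set (Bilin k p × Tensors m r s p)
  homogeneous : ∀ {μ γ}, (μ, γ) ∈ Γ → IsHomogeneous μ γ
  /-- `Γ` is closed under the equivariant equivalences `diag(a, h)` -/
  act_mem : ∀ {μ γ}, (μ, γ) ∈ Γ → ∀ (a : (k →L[ℝ] k)ˣ) (h : (p →L[ℝ] p)ˣ),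
    (bracketAct a h μ, tensorAct h γ) ∈ Γ
  smul_mem : ∀ {μ γ}, (μ, γ) ∈ Γ → ∀ c : ℝ, 0 < c → (μ, c • γ) ∈ Γ
  /-- the preferred direction -/
  q : Bilin k p → Tensors m r s p → Tensors m r s p
  /-- `q(γ)` is tangent to the `GL(p)`-orbit of `γ` -/
  tangent : ∀ {μ γ}, (μ, γ) ∈ Γ → ∃ B : p →L[ℝ] p, q μ γ = tensorRep B γ
  /-- `q` commutes with the equivariant equivalences `diag(a, h)` -/
  equivariant : ∀ {μ γ}, (μ, γ) ∈ Γ → ∀ (a : (k →L[ℝ] k)ˣ) (h : (p →L[ℝ] p)ˣ),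
    q (bracketAct a h μ) (tensorAct h γ) = tensorAct h (q μ γ)
  /-- the scaling exponent -/
  α : ℝ
  α_lt_one : α < 1
  scaling : ∀ {μ γ}, (μ, γ) ∈ Γ → ∀ c : ℝ, 0 < c → q μ (c • γ) = c ^ α • q μ γ
  /-- on each homogeneous space, the vector field `q` is regular enough to have unique integral
  curves -/
  lipschitz : ∀ μ, LocallyLipschitzOn {γ | (μ, γ) ∈ Γ} (q μ)

/-- `(G_μ/K_μ, γ)` is a semi-algebraic soliton: `q(γ) = c γ + θ(D_p) γ` with `D ∈ Der(𝔤/𝔨)`. -/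
structure IsSemiAlgebraicSoliton {m r s : ℕ} (P : PreferredDirection k p m r s)
    (μ : Bilin k p) (γ : Tensors m r s p) (c : ℝ) (D : (k × p) →L[ℝ] (k × p)) : Prop where
  mem : (μ, γ) ∈ P.Γ
  isDerivation : IsDerivation μ D
  eq : P.q μ γ = c • γ + tensorRep (pBlock D) γ

/-- `ν` solves the bracket flow `ν' = -θ(diag(0, Q_ν)) ν` on the set `J` of times, where
`Q_ν ∈ 𝔮` is the unique operator with `θ(Q_ν)γ = q(G_ν/K_ν, γ)`, and is continuous in time. -/
def IsBracketFlowSolution {m r s : ℕ} (P : PreferredDirection k p m r s) (γ : Tensors m r s p)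
    (𝔮 : Submodule ℝ (p →L[ℝ] p)) (ν : ℝ → Bilin k p) (J : Set ℝ) : Prop :=
  ∃ Q : ℝ → (p →L[ℝ] p), ContinuousOn Q J ∧ ∀ t ∈ J,
    (ν t, γ) ∈ P.Γ ∧ Q t ∈ 𝔮 ∧ tensorRep (Q t) γ = P.q (ν t) γ ∧
    HasDerivAt ν (-bracketRep (diagP k (Q t)) (ν t)) t

end Brackets

/-- `c(t) = ((1 - α) c t + 1)^(1/(1-α))`. -/
def cFun (α c t : ℝ) : ℝ := ((1 - α) * c * t + 1) ^ (1 / (1 - α))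

/-- `s(t) = log((1 - α) c t + 1) / ((1 - α) c)`, and `s(t) = t` if `c = 0`. -/
def sFun (α c t : ℝ) : ℝ :=
  if c = 0 then t else Real.log ((1 - α) * c * t + 1) / ((1 - α) * c)

/-- The open interval of times around `0` on which `c(t)` and `s(t)` are defined. -/
def timeInterval (α c : ℝ) : Set ℝ := {t | 0 < (1 - α) * c * t + 1}

end

end HomFlow

open scoped Topology NNReal

namespace HomFlow

/-! ### The action of `GL(p)` and of its Lie algebra on tensors. -/

section Tensors

variable {p : Type*} [NormedAddCommGroup p] [NormedSpace ℝ p] {m r s : ℕ}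

/-! Existence. Put `a = c/(s-r)`, `B = D_p - A`, `E = A - aI` and `Q₀ = B + aI`. Since `θ(I)γ =
(s-r)γ`, the operator `Q₀` lies in `𝔮` and represents `q(μ,γ)`, while `θ(E)γ = -cγ`. As `c(t) =
exp(c s(t))`, the claimed curve is `u(t)·μ` with `u(t) = exp(s(t)E)` (`bracketScale_expUnit`).
Equivariance and scaling of `q` then show that `q(μ(t),γ)` is represented by `s'(t) u Q₀ u⁻¹`.
Scalars drop out of the conjugation, so it is conjugation by `exp(s(t)A)`, which fixes `γ`; hence
this operator stays in `𝔮` and is `Q_{μ(t)}`. Finally `E + Q₀ = D_p` and `diag(0, D_p)` is a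
derivation, so `-θ(Q₀)` and `θ(E)` agree on `μ`, which turns the derivative of `u(t)·μ` into the
bracket flow equation (`soliton_isBracketFlowSolution`).

Uniqueness. Regularity of `q` is assumed only in `γ` for fixed `μ`, so uniqueness theorems do not
apply to the bracket flow directly. Instead, solve `u' = -Q u` along a solution `ν`: then `ν =
u·ν(t₀)`, and `u⁻¹·γ` is an integral curve of `q` on the fixed space `ν(t₀)` (`exists_gauge`), hence
unique. For two solutions, `φ = u₂u₁⁻¹` therefore stabilizes `γ`; invariance of `𝔮` gives `Q₂ = φ Q₁
φ⁻¹`, so `φ' = 0` and `φ = 1` (`IsBracketFlowSolution.eventually_eq`). Connectedness makes this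
global. -/

theorem tensors_ext {γ γ' : Tensors m r s p}
    (h : ∀ i v ξ, TensorPow.eval ξ (γ i v) = TensorPow.eval ξ (γ' i v)) : γ = γ' :=
  funext fun i => ContinuousMultilinearMap.ext fun v => TensorPow.ext fun ξ => h i v ξ

theorem tensorAct_apply (h : (p →L[ℝ] p)ˣ) (γ : Tensors m r s p) (i : Fin m) (v : Fin r → p)
    (ξ : Fin s → (p →L[ℝ] ℝ)) :
    TensorPow.eval ξ (tensorAct h γ i v)
      = TensorPow.eval (fun j => (ξ j).comp (h : p →L[ℝ] p))
          (γ i fun l => ((h⁻¹ : (p →L[ℝ] p)ˣ) : p →L[ℝ] p) (v l)) := rfl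

theorem tensorAct_smul (h : (p →L[ℝ] p)ˣ) (a : ℝ) (γ : Tensors m r s p) :
    tensorAct h (a • γ) = a • tensorAct h γ :=
  tensors_ext fun i v ξ => by
    simp only [Pi.smul_apply, smul_apply, map_smul, tensorAct_apply]

@[simp] theorem tensorAct_one (γ : Tensors m r s p) : tensorAct 1 γ = γ :=
  tensors_ext fun _ _ _ => rfl

theorem tensorAct_mul (g h : (p →L[ℝ] p)ˣ) (γ : Tensors m r s p) :
    tensorAct (g * h) γ = tensorAct g (tensorAct h γ) :=
  tensors_ext fun i v ξ => by
    simp only [tensorAct_apply, mul_inv_rev]; rfl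

theorem tensorRep_smul_right (a : ℝ) (A : p →L[ℝ] p) (γ : Tensors m r s p) :
    tensorRep A (a • γ) = a • tensorRep A γ :=
  tensors_ext fun i v ξ => by
    simp only [Pi.smul_apply, smul_apply, map_smul, tensorRep_apply, ← Finset.smul_sum, smul_sub]

theorem tensorRep_neg (A : p →L[ℝ] p) (γ : Tensors m r s p) :
    tensorRep (-A) γ = -tensorRep A γ := by
  rw [← neg_one_smul ℝ A, tensorRep_smul, neg_one_smul]

theorem tensorRep_sub (A B : p →L[ℝ] p) (γ : Tensors m r s p) :
    tensorRep (A - B) γ = tensorRep A γ - tensorRep B γ := by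
  rw [sub_eq_add_neg, tensorRep_add, tensorRep_neg, sub_eq_add_neg]

/-- For `r ≠ s` this makes every multiple of `γ` a value of `θ` on a scalar operator, so the term
`cγ` of the soliton equation can be absorbed into `𝔮`. -/
theorem tensorRep_one (γ : Tensors m r s p) :
    tensorRep 1 γ = ((s : ℝ) - (r : ℝ)) • γ :=
  tensors_ext fun i v ξ => by
    have h1 : ∀ j : Fin s, (ξ j).comp (1 : p →L[ℝ] p) = ξ j := fun j => rfl
    have h2 : ∀ l : Fin r, (1 : p →L[ℝ] p) (v l) = v l := fun l => rfl
    simp [tensorRep_apply, h1, sub_mul]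

theorem tensorAct_tensorRep (h : (p →L[ℝ] p)ˣ) (A : p →L[ℝ] p) (γ : Tensors m r s p) :
    tensorAct h (tensorRep A γ)
      = tensorRep ((h : p →L[ℝ] p) * A * ((h⁻¹ : (p →L[ℝ] p)ˣ) : p →L[ℝ] p)) (tensorAct h γ) :=
  tensors_ext fun i v ξ => by
    have hx : ∀ x, ((h⁻¹ : (p →L[ℝ] p)ˣ) : p →L[ℝ] p) ((h : p →L[ℝ] p) x) = x := fun x => by
      rw [← mul_apply_eq_comp, Units.inv_mul]; rfl
    rw [tensorAct_apply, tensorRep_apply, tensorRep_apply]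
    simp only [tensorAct_apply]
    congr 1
    · refine Finset.sum_congr rfl fun j _ => ?_
      congr 1
      refine congrArg TensorPow.eval (funext fun j' => ?_)
      rcases eq_or_ne j' j with rfl | hj
      · ext x; simp [hx]
      · simp [Function.update_of_ne hj]
    · refine Finset.sum_congr rfl fun l _ => ?_
      congr 2
      funext l'
      rcases eq_or_ne l' l with rfl | hl
      · simp [hx]
      · simp [Function.update_of_ne hl]

end Tensors

/-! ### Uniqueness of the operator in `𝔮`. -/

section Complement

variable {p : Type*} [NormedAddCommGroup p] [NormedSpace ℝ p] {m r s : ℕ}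
  {γ : Tensors m r s p} {𝔮 : Submodule ℝ (p →L[ℝ] p)}

theorem IsInvariantComplement.eq_of_tensorRep_eq (h𝔮 : IsInvariantComplement γ 𝔮)
    {B B' : p →L[ℝ] p} (hB : B ∈ 𝔮) (hB' : B' ∈ 𝔮) (h : tensorRep B γ = tensorRep B' γ) :
    B = B' := by
  rw [← sub_eq_zero, ← Submodule.mem_bot ℝ, ← h𝔮.isCompl.inf_eq_bot]
  refine ⟨?_, 𝔮.sub_mem hB hB'⟩
  change tensorRep (B - B') γ = 0
  rw [tensorRep_sub, h, sub_self]

end Complement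

/-! ### The action of `GL(p)` on brackets. -/

section Brackets

variable {k p : Type*} [NormedAddCommGroup k] [NormedSpace ℝ k]
  [NormedAddCommGroup p] [NormedSpace ℝ p]

theorem bilin_ext {μ ν : Bilin k p} (h : ∀ X Y, μ X Y = ν X Y) : μ = ν :=
  ContinuousLinearMap.ext fun X => ContinuousLinearMap.ext fun Y => h X Y

theorem bracketAct_one_apply (h : (p →L[ℝ] p)ˣ) (μ : Bilin k p) (X Y : k × p) :
    bracketAct 1 h μ X Y
      = (1 : k →L[ℝ] k).prodMap (h : p →L[ℝ] p)
          (μ ((1 : k →L[ℝ] k).prodMap ((h⁻¹ : (p →L[ℝ] p)ˣ) : p →L[ℝ] p) X)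
            ((1 : k →L[ℝ] k).prodMap ((h⁻¹ : (p →L[ℝ] p)ˣ) : p →L[ℝ] p) Y)) := rfl

@[simp] theorem bracketAct_one_one (μ : Bilin k p) : bracketAct 1 1 μ = μ :=
  bilin_ext fun _ _ => rfl

theorem bracketAct_one_mul (g h : (p →L[ℝ] p)ˣ) (μ : Bilin k p) :
    bracketAct 1 (g * h) μ = bracketAct 1 g (bracketAct 1 h μ) :=
  bilin_ext fun X Y => by
    simp only [bracketAct_one_apply, mul_inv_rev]; rfl

theorem bracketRep_diagP_add (A B : p →L[ℝ] p) (μ : Bilin k p) :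
    bracketRep (diagP k (A + B)) μ = bracketRep (diagP k A) μ + bracketRep (diagP k B) μ := by
  have h : diagP k (A + B) = diagP k A + diagP k B := by
    ext x <;> simp [diagP]
  refine bilin_ext fun X Y => ?_
  simp only [h, bracketRep_apply, add_apply, map_add]
  abel

theorem bracketRep_diagP_smul (a : ℝ) (A : p →L[ℝ] p) (μ : Bilin k p) :
    bracketRep (diagP k (a • A)) μ = a • bracketRep (diagP k A) μ := by
  have h : diagP k (a • A) = a • diagP k A := by
    ext x <;> simp [diagP]
  refine bilin_ext fun X Y => ?_
  simp only [h, bracketRep_apply, smul_apply, map_smul, smul_sub]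

theorem bracketAct_bracketRep (h : (p →L[ℝ] p)ˣ) (A : p →L[ℝ] p) (μ : Bilin k p) :
    bracketAct 1 h (bracketRep (diagP k A) μ)
      = bracketRep (diagP k ((h : p →L[ℝ] p) * A * ((h⁻¹ : (p →L[ℝ] p)ˣ) : p →L[ℝ] p)))
          (bracketAct 1 h μ) := by
  have hx : ∀ x, ((h⁻¹ : (p →L[ℝ] p)ˣ) : p →L[ℝ] p) ((h : p →L[ℝ] p) x) = x := fun x => by
    rw [← mul_apply_eq_comp, Units.inv_mul]; rfl
  refine bilin_ext fun ⟨X₁, X₂⟩ ⟨Y₁, Y₂⟩ => ?_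
  simp only [bracketAct_one_apply, bracketRep_apply, map_sub]
  simp [diagP, hx, Prod.ext_iff]

theorem bracketAct_one_neg (h : (p →L[ℝ] p)ˣ) (μ : Bilin k p) :
    bracketAct 1 h (-μ) = -bracketAct 1 h μ :=
  bilin_ext fun X Y => by simp [bracketAct_one_apply, Prod.ext_iff]

theorem bracketAct_one_zero (h : (p →L[ℝ] p)ˣ) :
    bracketAct 1 h (0 : Bilin k p) = 0 :=
  bilin_ext fun X Y => by simp [bracketAct_one_apply, Prod.ext_iff]

theorem IsDerivation.bracketRep_eq_zero {μ : Bilin k p} {D : (k × p) →L[ℝ] (k × p)}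
    (hD : IsDerivation μ D) : bracketRep D μ = 0 :=
  bilin_ext fun X Y => by simp [hD.leibniz]

/-- Scaling is the action of `x⁻¹I`, so it composes with `h` to `x⁻¹h`; here `g` is any unit with
that value. -/
theorem bracketScale_bracketAct {x : ℝ} (g h : (p →L[ℝ] p)ˣ)
    (hg : (g : p →L[ℝ] p) = x⁻¹ • (h : p →L[ℝ] p))
    (hg' : ((g⁻¹ : (p →L[ℝ] p)ˣ) : p →L[ℝ] p) = x • ((h⁻¹ : (p →L[ℝ] p)ˣ) : p →L[ℝ] p))
    (μ : Bilin k p) :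
    bracketScale x (bracketAct 1 h μ) = bracketAct 1 g μ :=
  bilin_ext fun ⟨X₁, X₂⟩ ⟨Y₁, Y₂⟩ => by
    simp [bracketAct_one_apply, bracketScale, hg, hg', Prod.ext_iff]

end Brackets

/-! ### Product rules for compositions of linear and multilinear maps. -/

section Multilinear

variable {V V' W W' : Type*} [NormedAddCommGroup V] [NormedSpace ℝ V] [NormedAddCommGroup V']
  [NormedSpace ℝ V'] [NormedAddCommGroup W] [NormedSpace ℝ W] [NormedAddCommGroup W']
  [NormedSpace ℝ W'] {n : ℕ}

theorem hasDerivAt_clm_comp_const {f : ℝ → V} {f' : V} {t : ℝ} (L : V →L[ℝ] W)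
    (hf : HasDerivAt f f' t) : HasDerivAt (fun x => L (f x)) (L f') t :=
  L.hasFDerivAt.comp_hasDerivAt t hf

theorem hasDerivAt_cmm_diag (L : ContinuousMultilinearMap ℝ (fun _ : Fin n => V) W)
  {f : ℝ → V} {f' : V} {t : ℝ} (hf : HasDerivAt f f' t) :
    HasDerivAt (fun x => L (fun _ => f x))
      (∑ l : Fin n, L (Function.update (fun _ => f t) l f')) t := by
  have h1 : HasDerivAt (fun x => fun _ : Fin n => f x) (fun _ => f') t := hasDerivAt_pi.2 fun _ => hf
  have h := HasFDerivAt.comp_hasDerivAt (f := fun x => fun _ : Fin n => f x) t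
    (L.hasFDerivAt (fun _ => f t)) h1
  refine h.congr_deriv ?_
  rw [ContinuousMultilinearMap.linearDeriv_apply]

/-- Precomposition is itself multilinear in the family of linear maps, so the Leibniz rule on the
diagonal applies. -/
theorem hasDerivAt_compContinuousLinearMapL {B : ℝ → (V →L[ℝ] V')} {B' : V →L[ℝ] V'} {t : ℝ}
    (hB : HasDerivAt B B' t) :
    HasDerivAt (fun x => ContinuousMultilinearMap.compContinuousLinearMapL (F := W)
        fun _ : Fin n => B x)
      (∑ l : Fin n, ContinuousMultilinearMap.compContinuousLinearMapL
        (Function.update (fun _ => B t) l B')) t :=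
  hasDerivAt_cmm_diag (V := V →L[ℝ] V')
    (W := ContinuousMultilinearMap ℝ (fun _ : Fin n => V') W →L[ℝ]
      ContinuousMultilinearMap ℝ (fun _ : Fin n => V) W)
    (ContinuousMultilinearMap.compContinuousLinearMapContinuousMultilinear ℝ (fun _ : Fin n => V) (fun _ : Fin n => V') W) hB

theorem hasDerivAt_precomp {C : ℝ → (V →L[ℝ] V')} {C' : V →L[ℝ] V'} {t : ℝ}
    (hC : HasDerivAt C C' t) :
    HasDerivAt (fun x => (ContinuousLinearMap.compL ℝ V V' W).flip (C x))
      ((ContinuousLinearMap.compL ℝ V V' W).flip C') t :=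
  hasDerivAt_clm_comp_const (V := (V →L[ℝ] V')) (W := (V' →L[ℝ] W) →L[ℝ] (V →L[ℝ] W))
    (ContinuousLinearMap.compL ℝ V V' W).flip hC

theorem hasDerivAt_postcomp {C : ℝ → (V' →L[ℝ] W)} {C' : V' →L[ℝ] W} {t : ℝ}
    (hC : HasDerivAt C C' t) :
    HasDerivAt (fun x => (ContinuousLinearMap.compL ℝ V V' W) (C x))
      ((ContinuousLinearMap.compL ℝ V V' W) C') t :=
  hasDerivAt_clm_comp_const (V := (V' →L[ℝ] W)) (W := (V →L[ℝ] V') →L[ℝ] (V →L[ℝ] W))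
    (ContinuousLinearMap.compL ℝ V V' W) hC

theorem hasDerivAt_one_prodMap {C : ℝ → (V →L[ℝ] V)} {C' : V →L[ℝ] V} {t : ℝ}
    (hC : HasDerivAt C C' t) :
    HasDerivAt (fun x => (1 : W →L[ℝ] W).prodMap (C x))
      ((0 : W →L[ℝ] W).prodMap C') t := by
  have h1 : HasDerivAt (fun x => ((1 : W →L[ℝ] W), C x)) ((0 : W →L[ℝ] W), C') t :=
    (hasDerivAt_const t (1 : W →L[ℝ] W)).prodMk hC
  exact hasDerivAt_clm_comp_const (V := (W →L[ℝ] W) × (V →L[ℝ] V)) (W := (W × V) →L[ℝ] W × V)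
    (ContinuousLinearMap.prodMapL ℝ W W V V) h1

theorem hasDerivAt_compContinuousMultilinearMap {C : ℝ → (W →L[ℝ] W')} {C' : W →L[ℝ] W'}
    {γ : ℝ → ContinuousMultilinearMap ℝ (fun _ : Fin n => V) W}
    {γ' : ContinuousMultilinearMap ℝ (fun _ : Fin n => V) W} {t : ℝ} (hC : HasDerivAt C C' t)
    (hγ : HasDerivAt γ γ' t) :
    HasDerivAt (fun x => (C x).compContinuousMultilinearMap (γ x))
      (C'.compContinuousMultilinearMap (γ t) + (C t).compContinuousMultilinearMap γ') t := by
  have h1 := hasDerivAt_clm_comp_const (V := W →L[ℝ] W')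
    (W := ContinuousMultilinearMap ℝ (fun _ : Fin n => V) W →L[ℝ]
      ContinuousMultilinearMap ℝ (fun _ : Fin n => V) W')
    (ContinuousLinearMap.compContinuousMultilinearMapL ℝ (fun _ : Fin n => V) W W') hC
  exact h1.clm_apply hγ

theorem hasDerivAt_compContinuousLinearMap {B : ℝ → (V →L[ℝ] V')} {B' : V →L[ℝ] V'} {t : ℝ}
    (hB : HasDerivAt B B' t) (γ : ContinuousMultilinearMap ℝ (fun _ : Fin n => V') W) :
    HasDerivAt (fun x => γ.compContinuousLinearMap fun _ => B x)
      (∑ l : Fin n, γ.compContinuousLinearMap (Function.update (fun _ => B t) l B')) t := by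
  refine ((hasDerivAt_compContinuousLinearMapL hB).clm_apply
    (hasDerivAt_const t γ)).congr_deriv ?_
  refine ContinuousMultilinearMap.ext fun v => ?_
  simp

end Multilinear

/-! ### Derivatives of orbits along a curve in `GL(p)`. -/

section Derivatives

variable {k p : Type*} [NormedAddCommGroup k] [NormedSpace ℝ k]
  [NormedAddCommGroup p] [NormedSpace ℝ p] {m r s : ℕ}

theorem hasDerivAt_units_inv [CompleteSpace p] {u : ℝ → (p →L[ℝ] p)ˣ} {w : p →L[ℝ] p} {t : ℝ}
    (hu : HasDerivAt (fun x => (u x : p →L[ℝ] p)) w t) :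
    HasDerivAt (fun x => (((u x)⁻¹ : (p →L[ℝ] p)ˣ) : p →L[ℝ] p))
      (-(((u t)⁻¹ : (p →L[ℝ] p)ˣ) * w * ((u t)⁻¹ : (p →L[ℝ] p)ˣ))) t := by
  have h := (hasFDerivAt_ringInverse (𝕜 := ℝ) (u t)).comp_hasDerivAt t hu
  simpa [Function.comp_def, Ring.inverse_unit] using h

theorem hasDerivAt_tensorPow_map {C : ℝ → (p →L[ℝ] p)} {C' : p →L[ℝ] p} {t : ℝ}
    (hC : HasDerivAt C C' t) :
    HasDerivAt (fun x => TensorPow.map (s := s) fun _ => C x)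
      (∑ j : Fin s, TensorPow.map (Function.update (fun _ => C t) j C')) t := by
  have h := hasDerivAt_compContinuousLinearMapL (n := s) (W := ℝ)
    (hasDerivAt_precomp (W := ℝ) hC)
  refine HasDerivAt.congr_deriv (f := fun x => TensorPow.map (s := s) fun _ => C x) h ?_
  refine Finset.sum_congr rfl fun j _ => ?_
  refine congrArg (ContinuousMultilinearMap.compContinuousLinearMapL (F := ℝ))
    (funext fun j' => ?_)
  rcases eq_or_ne j' j with rfl | hj
  · simp
  · simp [Function.update_of_ne hj]

/-- The Leibniz rule, with the velocity written as `u'u⁻¹` at the moved tensor. The minus signs of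
`tensorRep` come from the derivative of `u⁻¹` in the arguments. -/
theorem hasDerivAt_tensorAct [CompleteSpace p] {u : ℝ → (p →L[ℝ] p)ˣ} {w : p →L[ℝ] p} {t : ℝ}
    (hu : HasDerivAt (fun x => (u x : p →L[ℝ] p)) w t) (γ : Tensors m r s p) :
    HasDerivAt (fun x => tensorAct (u x) γ)
      (tensorRep (w * ((u t)⁻¹ : (p →L[ℝ] p)ˣ)) (tensorAct (u t) γ)) t := by
  rw [hasDerivAt_pi]
  intro i
  refine HasDerivAt.congr_deriv (f := fun x => tensorAct (u x) γ i)
    (hasDerivAt_compContinuousMultilinearMap (hasDerivAt_tensorPow_map (s := s) hu)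
      (hasDerivAt_compContinuousLinearMap (hasDerivAt_units_inv hu) (γ i))) ?_
  have hx : ∀ x, (((u t)⁻¹ : (p →L[ℝ] p)ˣ) : p →L[ℝ] p) ((u t : p →L[ℝ] p) x) = x := fun x => by
    rw [← mul_apply_eq_comp, Units.inv_mul]; rfl
  refine ContinuousMultilinearMap.ext fun v => TensorPow.ext fun ξ => ?_
  rw [tensorRep_apply]
  simp only [tensorAct_apply]
  simp only [add_apply, ContinuousLinearMap.compContinuousMultilinearMap_coe, Function.comp_apply,
    sum_apply, map_add, map_sum, TensorPow.eval_map,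
    ContinuousMultilinearMap.compContinuousLinearMap_apply]
  rw [sub_eq_add_neg, ← Finset.sum_neg_distrib]
  congr 1
  · refine Finset.sum_congr rfl fun j _ => ?_
    refine congrArg (fun η => TensorPow.eval η _) (funext fun j' => ?_)
    rcases eq_or_ne j' j with rfl | hj
    · ext x; simp [hx]
    · simp [Function.update_of_ne hj]
  · refine Finset.sum_congr rfl fun l _ => ?_
    rw [← map_neg]
    have hneg : ∀ (a : Fin r → p) (y : p),
        -(γ i (Function.update a l y)) = γ i (Function.update a l (-y)) := fun a y => by
      rw [← neg_one_smul ℝ, ← neg_one_smul ℝ y, ContinuousMultilinearMap.map_update_smul]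
    have h1 : (fun l' => ((u t)⁻¹ : (p →L[ℝ] p)ˣ).val
        (Function.update v l ((w * ((u t)⁻¹ : (p →L[ℝ] p)ˣ)) (v l)) l'))
        = Function.update (fun l' => ((u t)⁻¹ : (p →L[ℝ] p)ˣ).val (v l')) l
          (((u t)⁻¹ : (p →L[ℝ] p)ˣ).val (w (((u t)⁻¹ : (p →L[ℝ] p)ˣ).val (v l)))) := by
      funext l'
      rcases eq_or_ne l' l with rfl | hl
      · simp
      · simp [Function.update_of_ne hl]
    rw [h1, hneg]
    congr 2
    funext l'
    rcases eq_or_ne l' l with rfl | hl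
    · simp
    · simp [Function.update_of_ne hl]

theorem hasDerivAt_bracketAct [CompleteSpace p] {u : ℝ → (p →L[ℝ] p)ˣ} {w : p →L[ℝ] p} {t : ℝ}
    (hu : HasDerivAt (fun x => (u x : p →L[ℝ] p)) w t) {ν : ℝ → Bilin k p} {ν' : Bilin k p}
    (hν : HasDerivAt ν ν' t) :
    HasDerivAt (fun x => bracketAct 1 (u x) (ν x))
      (bracketAct 1 (u t) ν'
        + bracketRep (diagP k (w * (((u t)⁻¹ : (p →L[ℝ] p)ˣ) : p →L[ℝ] p))) (bracketAct 1 (u t) (ν t))) t := by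
  have hg : HasDerivAt (fun x => (1 : k →L[ℝ] k).prodMap (u x : p →L[ℝ] p)) (diagP k w) t :=
    hasDerivAt_one_prodMap hu
  have hg' := hasDerivAt_one_prodMap (W := k) (hasDerivAt_units_inv hu)
  refine HasDerivAt.congr_deriv (f := fun x => bracketAct 1 (u x) (ν x))
    ((hasDerivAt_postcomp (V := k × p) hg).clm_comp
      ((hasDerivAt_precomp (W := k × p) hg').clm_comp (hν.clm_comp hg'))) ?_
  have hx : ∀ x, (((u t)⁻¹ : (p →L[ℝ] p)ˣ) : p →L[ℝ] p) ((u t : p →L[ℝ] p) x) = x := fun x => by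
    rw [← mul_apply_eq_comp, Units.inv_mul]; rfl
  refine bilin_ext fun ⟨X₁, X₂⟩ ⟨Y₁, Y₂⟩ => ?_
  simp [bracketAct_one_apply, diagP, Prod.ext_iff, hx]
  have hn : ∀ x : p, ((0 : k), -x) = -((0 : k), x) := fun x => by simp
  simp only [hn, map_neg, neg_apply, Prod.fst_neg, Prod.snd_neg]
  constructor <;> abel

end Derivatives

/-! ### Linear differential equations in a Banach algebra. -/

section ODE

theorem eventually_eq_const_of_hasDerivAt_zero {E : Type*} [NormedAddCommGroup E] [NormedSpace ℝ E]
    {f : ℝ → E} {t₀ : ℝ} (hf : ∀ᶠ t in 𝓝 t₀, HasDerivAt f 0 t) : ∀ᶠ t in 𝓝 t₀, f t = f t₀ :=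
  ODE_solution_unique_of_eventually (v := fun _ _ => (0 : E)) (s := fun _ => Set.univ) (K := 0)
    (g := fun _ => f t₀)
    (Filter.Eventually.of_forall fun _ => (LipschitzWith.const (0 : E)).lipschitzOnWith)
    (hf.mono fun _ h => ⟨h, trivial⟩)
    (Filter.Eventually.of_forall fun t => ⟨hasDerivAt_const t _, trivial⟩) rfl

/-- Picard–Lindelöf on the unit ball around `1`: near `t₀`, `M` bounds `Q`, hence is a Lipschitz
constant, and `L` bounds the field on that ball. -/
theorem exists_linear_ode_solution {𝔸 : Type*} [NormedRing 𝔸] [NormedAlgebra ℝ 𝔸]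
    [CompleteSpace 𝔸] {Q : ℝ → 𝔸} {J : Set ℝ} {t₀ : ℝ} (hJ : J ∈ 𝓝 t₀) (hQ : ContinuousOn Q J) :
    ∃ f : ℝ → 𝔸, f t₀ = 1 ∧ ∀ᶠ t in 𝓝 t₀, HasDerivAt f (-(Q t * f t)) t := by
  set M : ℝ≥0 := ‖Q t₀‖₊ + 1
  set L : ℝ≥0 := M * (‖(1 : 𝔸)‖₊ + 1)
  have hM : ∀ᶠ t in 𝓝 t₀, ‖Q t‖ ≤ M := by
    have h := (hQ.continuousAt hJ).norm.eventually_lt_const (lt_add_one ‖Q t₀‖)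
    exact h.mono fun t ht => by simpa [M] using ht.le
  obtain ⟨ε, hε, hball⟩ := Metric.eventually_nhds_iff_ball.1 (hM.and hJ)
  -- `ε / 2` keeps the closed interval inside the open ball; `1 / (L + 1)` gives `L * δ ≤ 1`, so
  -- solutions stay in the unit ball.
  set δ : ℝ := min (ε / 2) (1 / (L + 1))
  have hδ : 0 < δ := lt_min (by positivity) (by positivity)
  have hsub : ∀ t ∈ Set.Icc (t₀ - δ) (t₀ + δ), ‖Q t‖ ≤ M ∧ t ∈ J := fun t ht => by
    refine hball t ?_
    rw [Metric.mem_ball, Real.dist_eq, abs_lt]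
    have := min_le_left (ε / 2) (1 / ((L : ℝ) + 1))
    constructor <;> linarith [ht.1, ht.2]
  have hpl : IsPicardLindelof (fun t x => -(Q t * x)) (tmin := t₀ - δ) (tmax := t₀ + δ)
      ⟨t₀, by constructor <;> linarith⟩ (1 : 𝔸) 1 0 L M := by
    refine ⟨fun t ht => ?_, fun x _ => ?_, fun t ht x hx => ?_, ?_⟩
    · refine LipschitzOnWith.of_dist_le_mul fun x _ y _ => ?_
      rw [dist_neg_neg, dist_eq_norm, dist_eq_norm, ← mul_sub]
      exact (norm_mul_le _ _).trans
        (mul_le_mul_of_nonneg_right (hsub t ht).1 (norm_nonneg _))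
    · exact ((hQ.mono fun t ht => (hsub t ht).2).mul continuousOn_const).neg
    · have hx1 : ‖x‖ ≤ ‖(1 : 𝔸)‖ + 1 := by
        have h1 : dist x 1 ≤ 1 := by simpa using hx
        rw [dist_eq_norm] at h1
        linarith [norm_le_norm_add_norm_sub' x 1]
      rw [norm_neg]
      refine (norm_mul_le _ _).trans ?_
      simp only [L, NNReal.coe_mul, NNReal.coe_add, coe_nnnorm, NNReal.coe_one]
      exact mul_le_mul (hsub t ht).1 hx1 (norm_nonneg _) M.2
    · have h1 : (L : ℝ) * δ ≤ L * (1 / (L + 1)) := by gcongr; exact min_le_right _ _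
      have h2 : (L : ℝ) * (1 / (L + 1)) ≤ 1 := by
        rw [mul_one_div, div_le_one (by positivity)]; linarith
      simpa using h1.trans h2
  obtain ⟨f, hf0, hf⟩ := hpl.exists_eq_forall_mem_Icc_hasDerivWithinAt₀
  refine ⟨f, hf0, ?_⟩
  filter_upwards [Ioo_mem_nhds (sub_lt_self t₀ hδ) (lt_add_of_pos_right t₀ hδ)] with t ht
  exact (hf t (Set.Ioo_subset_Icc_self ht)).hasDerivAt (Icc_mem_nhds ht.1 ht.2)

/-- Units form an open set containing the initial value `1`, so the solution is invertible near
`t₀`; elsewhere the value `1` is a placeholder. -/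
theorem exists_units_linear_ode_solution {𝔸 : Type*} [NormedRing 𝔸] [NormedAlgebra ℝ 𝔸]
    [CompleteSpace 𝔸] {Q : ℝ → 𝔸} {J : Set ℝ} {t₀ : ℝ} (hJ : J ∈ 𝓝 t₀) (hQ : ContinuousOn Q J) :
    ∃ u : ℝ → 𝔸ˣ, u t₀ = 1 ∧
      ∀ᶠ t in 𝓝 t₀, HasDerivAt (fun x => (u x : 𝔸)) (-(Q t * u t)) t := by
  classical
  obtain ⟨f, hf0, hf⟩ := exists_linear_ode_solution hJ hQ
  have hunit : ∀ᶠ t in 𝓝 t₀, IsUnit (f t) :=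
    hf.self_of_nhds.continuousAt.eventually_mem
      (Units.isOpen.mem_nhds (by rw [hf0]; exact isUnit_one))
  refine ⟨fun t => if h : IsUnit (f t) then h.unit else 1, ?_, ?_⟩
  · ext
    simp [hf0]
  · filter_upwards [hf, hunit.eventually_nhds] with t ht hut
    have heq : ∀ᶠ x in 𝓝 t, ((if h : IsUnit (f x) then h.unit else 1 : 𝔸ˣ) : 𝔸) = f x :=
      hut.mono fun x hx => by simp [hx]
    rw [heq.self_of_nhds]
    exact ht.congr_of_eventuallyEq heq

end ODE

/-! ### Uniqueness of bracket flow solutions. -/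

section Uniqueness

variable {k p : Type*} [NormedAddCommGroup k] [NormedSpace ℝ k]
  [NormedAddCommGroup p] [NormedSpace ℝ p] {m r s : ℕ} (P : PreferredDirection k p m r s)
  {γ : Tensors m r s p} {𝔮 : Submodule ℝ (p →L[ℝ] p)}

/-- A bracket flow solution is, locally, the pull-back of a fixed homogeneous space by a curve in
`GL(p)` whose inverse moves `γ` along an integral curve of the preferred direction. -/
theorem exists_gauge [CompleteSpace p] {Q : ℝ → (p →L[ℝ] p)} {ν : ℝ → Bilin k p} {J : Set ℝ}
    {t₀ : ℝ} (hJ : J ∈ 𝓝 t₀) (hQ : ContinuousOn Q J)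
    (h : ∀ t ∈ J, (ν t, γ) ∈ P.Γ ∧ Q t ∈ 𝔮 ∧ tensorRep (Q t) γ = P.q (ν t) γ ∧
      HasDerivAt ν (-bracketRep (diagP k (Q t)) (ν t)) t) :
    ∃ u : ℝ → (p →L[ℝ] p)ˣ, u t₀ = 1 ∧ ∀ᶠ t in 𝓝 t₀,
      HasDerivAt (fun x => (u x : p →L[ℝ] p)) (-(Q t * u t)) t ∧
      ν t = bracketAct 1 (u t) (ν t₀) ∧
      HasDerivAt (fun x => tensorAct (u x)⁻¹ γ) (P.q (ν t₀) (tensorAct (u t)⁻¹ γ)) t ∧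
      (ν t₀, tensorAct (u t)⁻¹ γ) ∈ P.Γ := by
  obtain ⟨u, hu0, hu⟩ := exists_units_linear_ode_solution hJ hQ
  have hinv : ∀ᶠ t in 𝓝 t₀, HasDerivAt (fun x => (((u x)⁻¹ : (p →L[ℝ] p)ˣ) : p →L[ℝ] p))
      (((u t)⁻¹ : (p →L[ℝ] p)ˣ) * Q t) t := hu.mono fun t ht => by
    refine (hasDerivAt_units_inv ht).congr_deriv ?_
    rw [mul_neg, neg_mul, neg_neg, mul_assoc, mul_assoc, Units.mul_inv, mul_one]
  -- The derivative vanishes: `u⁻¹·(-θ(Q)ν)` cancels `θ(u⁻¹Qu)(u⁻¹·ν)`.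
  have hback : ∀ᶠ t in 𝓝 t₀, bracketAct 1 (u t)⁻¹ (ν t) = ν t₀ := by
    have hc := eventually_eq_const_of_hasDerivAt_zero
      (f := fun t => bracketAct 1 (u t)⁻¹ (ν t)) (t₀ := t₀) (by
        filter_upwards [hinv, hJ] with t ht htJ
        refine (hasDerivAt_bracketAct ht (h t htJ).2.2.2).congr_deriv ?_
        rw [bracketAct_one_neg, bracketAct_bracketRep]
        exact neg_add_cancel (G := Bilin k p) _)
    simpa [hu0] using hc
  refine ⟨u, hu0, ?_⟩
  filter_upwards [hu, hinv, hback, hJ] with t htu hti htb htJ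
  obtain ⟨hmem, -, hq, -⟩ := h t htJ
  refine ⟨htu, ?_, ?_, ?_⟩
  · rw [← htb, ← bracketAct_one_mul, mul_inv_cancel, bracketAct_one_one]
  -- `θ(u⁻¹Qu)(u⁻¹·γ) = u⁻¹·θ(Q)γ = u⁻¹·q(ν,γ)`, and equivariance moves `u⁻¹` inside `q`.
  · refine (hasDerivAt_tensorAct hti γ).congr_deriv ?_
    rw [← tensorAct_tensorRep, hq, ← P.equivariant hmem 1, htb]
  · have := P.act_mem hmem 1 (u t)⁻¹
    rwa [htb] at this

/-- `q` is Lipschitz only on a relative neighbourhood `S` within the slice of `Γ` over `μ`;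
continuous curves in that slice remain in `S` for a short time. -/
theorem integralCurve_unique (μ : Bilin k p) {γ₁ γ₂ : ℝ → Tensors m r s p} {t₀ : ℝ}
    (h₁ : ∀ᶠ t in 𝓝 t₀, HasDerivAt γ₁ (P.q μ (γ₁ t)) t ∧ (μ, γ₁ t) ∈ P.Γ)
    (h₂ : ∀ᶠ t in 𝓝 t₀, HasDerivAt γ₂ (P.q μ (γ₂ t)) t ∧ (μ, γ₂ t) ∈ P.Γ)
    (h : γ₁ t₀ = γ₂ t₀) : ∀ᶠ t in 𝓝 t₀, γ₁ t = γ₂ t := by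
  obtain ⟨K, S, hS, hK⟩ := P.lipschitz μ (h₁.self_of_nhds.2 : γ₁ t₀ ∈ {γ | (μ, γ) ∈ P.Γ})
  have hmem : ∀ {γ' : ℝ → Tensors m r s p},
      (∀ᶠ t in 𝓝 t₀, HasDerivAt γ' (P.q μ (γ' t)) t ∧ (μ, γ' t) ∈ P.Γ) → γ' t₀ = γ₁ t₀ →
      ∀ᶠ t in 𝓝 t₀, HasDerivAt γ' (P.q μ (γ' t)) t ∧ γ' t ∈ S := fun {γ'} h' h0 => by
    have hc : Filter.Tendsto γ' (𝓝 t₀) (𝓝[{γ | (μ, γ) ∈ P.Γ}] (γ₁ t₀)) :=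
      tendsto_nhdsWithin_iff.2 ⟨h0 ▸ h'.self_of_nhds.1.continuousAt, h'.mono fun t ht => ht.2⟩
    filter_upwards [h', hc hS] with t ht htS using ⟨ht.1, htS⟩
  exact ODE_solution_unique_of_eventually (v := fun _ => P.q μ) (s := fun _ => S) (K := K)
    (Filter.Eventually.of_forall fun _ => hK) (hmem h₁ rfl) (hmem h₂ h.symm) h

/-- Both gauges move `γ` along the same integral curve, so they differ by stabilizer elements.
Invariance of `𝔮` then forces the difference to be constant. -/
theorem IsBracketFlowSolution.eventually_eq [CompleteSpace p] (h𝔮 : IsInvariantComplement γ 𝔮)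
    {ν₁ ν₂ : ℝ → Bilin k p} {J₁ J₂ : Set ℝ} {t₀ : ℝ} (hJ₁ : J₁ ∈ 𝓝 t₀) (hJ₂ : J₂ ∈ 𝓝 t₀)
    (h₁ : IsBracketFlowSolution P γ 𝔮 ν₁ J₁) (h₂ : IsBracketFlowSolution P γ 𝔮 ν₂ J₂)
    (h : ν₁ t₀ = ν₂ t₀) : ∀ᶠ t in 𝓝 t₀, ν₁ t = ν₂ t := by
  obtain ⟨Q₁, hQ₁, hs₁⟩ := h₁
  obtain ⟨Q₂, hQ₂, hs₂⟩ := h₂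
  obtain ⟨u₁, hu₁, hg₁⟩ := exists_gauge P hJ₁ hQ₁ hs₁
  obtain ⟨u₂, hu₂, hg₂⟩ := exists_gauge P hJ₂ hQ₂ hs₂
  rw [← h] at hg₂
  have hγ := integralCurve_unique P (ν₁ t₀) (hg₁.mono fun t ht => ht.2.2)
    (hg₂.mono fun t ht => ht.2.2) (by rw [hu₁, hu₂])
  have hφ : ∀ᶠ t in 𝓝 t₀, HasDerivAt
      (fun x => (u₂ x : p →L[ℝ] p) * (((u₁ x)⁻¹ : (p →L[ℝ] p)ˣ) : p →L[ℝ] p)) 0 t := by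
    filter_upwards [hg₁, hg₂, hγ, hJ₁, hJ₂] with t ht₁ ht₂ htγ htJ₁ htJ₂
    obtain ⟨hm₁, hq₁, he₁, -⟩ := hs₁ t htJ₁
    obtain ⟨-, hq₂, he₂, -⟩ := hs₂ t htJ₂
    have hfix : tensorAct (u₂ t * (u₁ t)⁻¹) γ = γ := by
      rw [tensorAct_mul, htγ, ← tensorAct_mul, mul_inv_cancel, tensorAct_one]
    have hν : ν₂ t = bracketAct 1 (u₂ t * (u₁ t)⁻¹) (ν₁ t) := by
      rw [bracketAct_one_mul, ht₁.2.1, ← bracketAct_one_mul (u₁ t)⁻¹, inv_mul_cancel,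
        bracketAct_one_one, ht₂.2.1]
    -- Both sides lie in `𝔮`, the right one because `u₂u₁⁻¹` fixes `γ`, and by equivariance both
    -- send `γ` to `q(ν₂,γ)`.
    have hQ : Q₂ t = ((u₂ t * (u₁ t)⁻¹ : (p →L[ℝ] p)ˣ) : p →L[ℝ] p) * Q₁ t
        * (((u₂ t * (u₁ t)⁻¹)⁻¹ : (p →L[ℝ] p)ˣ) : p →L[ℝ] p) := by
      refine h𝔮.eq_of_tensorRep_eq hq₂ (h𝔮.conj_mem _ hfix _ hq₁) ?_
      have h1 := P.equivariant hm₁ 1 (u₂ t * (u₁ t)⁻¹)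
      rw [← hν, hfix, ← he₁, tensorAct_tensorRep, hfix, ← he₂] at h1
      exact h1
    refine (ht₂.1.mul (hasDerivAt_units_inv ht₁.1)).congr_deriv ?_
    rw [hQ]
    simp only [mul_inv_rev, inv_inv, Units.val_mul, mul_neg, neg_mul, neg_neg, mul_assoc,
      Units.inv_mul_cancel_left, Units.mul_inv, mul_one]
    exact neg_add_cancel _
  have hone := eventually_eq_const_of_hasDerivAt_zero hφ
  filter_upwards [hone, hg₁, hg₂] with t ht ht₁ ht₂
  have hu : u₂ t * (u₁ t)⁻¹ = 1 := Units.ext (by simpa [hu₁, hu₂] using ht)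
  rw [ht₁.2.1, ht₂.2.1, mul_inv_eq_one.1 hu]

/-- The set of times near which the solutions agree is open by definition, and relatively closed by
continuity and local uniqueness. -/
theorem IsBracketFlowSolution.eqOn [CompleteSpace p] (h𝔮 : IsInvariantComplement γ 𝔮)
    {ν₁ ν₂ : ℝ → Bilin k p} {J₁ J₂ : Set ℝ} {t₀ : ℝ} (hJ₁ : IsOpen J₁) (hJ₂ : IsOpen J₂)
    (hJ : IsPreconnected (J₁ ∩ J₂)) (ht₀ : t₀ ∈ J₁ ∩ J₂)
    (h₁ : IsBracketFlowSolution P γ 𝔮 ν₁ J₁) (h₂ : IsBracketFlowSolution P γ 𝔮 ν₂ J₂)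
    (h : ν₁ t₀ = ν₂ t₀) : Set.EqOn ν₁ ν₂ (J₁ ∩ J₂) := by
  have hloc : ∀ t ∈ J₁ ∩ J₂, ν₁ t = ν₂ t → ∀ᶠ x in 𝓝 t, ν₁ x = ν₂ x := fun t ht he =>
    IsBracketFlowSolution.eventually_eq P h𝔮 (hJ₁.mem_nhds ht.1) (hJ₂.mem_nhds ht.2) h₁ h₂ he
  have hsub := hJ.subset_of_closure_inter_subset (u := {t | ∀ᶠ x in 𝓝 t, ν₁ x = ν₂ x})
    isOpen_setOfPred_eventually_nhds ⟨t₀, ht₀, hloc t₀ ht₀ h⟩ (by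
      rintro t ⟨htc, ht⟩
      refine hloc t ht ?_
      obtain ⟨Q₁, -, hs₁⟩ := h₁
      obtain ⟨Q₂, -, hs₂⟩ := h₂
      have hc₁ := HasDerivAt.continuousAt (𝕜 := ℝ) (F := Bilin k p) (hs₁ t ht.1).2.2.2
      have hc₂ := HasDerivAt.continuousAt (𝕜 := ℝ) (F := Bilin k p) (hs₂ t ht.2).2.2.2
      exact tendsto_nhds_unique_of_frequently_eq hc₁ hc₂
        ((mem_closure_iff_frequently.1 htc).mono fun x hx =>
          Filter.Eventually.self_of_nhds (p := fun y => ν₁ y = ν₂ y) hx))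
  exact fun t ht => (hsub ht).self_of_nhds

end Uniqueness

/-! ### One-parameter groups acting on eigentensors. -/

section Exponential

variable {p : Type*} [NormedAddCommGroup p] [NormedSpace ℝ p] [FiniteDimensional ℝ p] {m r s : ℕ}

theorem expUnit_val (A : p →L[ℝ] p) : (expUnit A : p →L[ℝ] p) = NormedSpace.exp A := rfl

theorem expUnit_inv_val (A : p →L[ℝ] p) :
    (((expUnit A)⁻¹ : (p →L[ℝ] p)ˣ) : p →L[ℝ] p) = NormedSpace.exp (-A) := rfl

theorem expUnit_zero : expUnit (0 : p →L[ℝ] p) = 1 := by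
  ext1
  rw [expUnit_val, NormedSpace.exp_zero, Units.val_one]

theorem exp_add_smul_one (B : p →L[ℝ] p) (a : ℝ) :
    NormedSpace.exp (B + a • (1 : p →L[ℝ] p)) = Real.exp a • NormedSpace.exp B := by
  have : CompleteSpace p := FiniteDimensional.complete ℝ p
  let _ : NormedAlgebra ℚ (p →L[ℝ] p) := .restrictScalars ℚ ℝ _
  have h := NormedSpace.algebraMap_exp_comm (𝕂 := ℝ) (𝔸 := p →L[ℝ] p) a
  rw [NormedSpace.exp_add_of_commute ((Commute.one_right B).smul_right a),
    ← Algebra.algebraMap_eq_smul_one, ← h, ← Real.exp_eq_exp_ℝ, Algebra.algebraMap_eq_smul_one,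
    mul_smul_comm, mul_one]

theorem hasDerivAt_expUnit (E : p →L[ℝ] p) (t : ℝ) :
    HasDerivAt (fun x : ℝ => (expUnit (x • E) : p →L[ℝ] p))
      (E * (expUnit (t • E) : p →L[ℝ] p)) t := by
  have : CompleteSpace p := FiniteDimensional.complete ℝ p
  exact hasDerivAt_exp_smul_const' E t

theorem expUnit_conj_self (E : p →L[ℝ] p) (t : ℝ) :
    (expUnit (t • E) : p →L[ℝ] p) * E * (((expUnit (t • E))⁻¹ : (p →L[ℝ] p)ˣ) : p →L[ℝ] p) = E := by
  have : CompleteSpace p := FiniteDimensional.complete ℝ p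
  let _ : NormedAlgebra ℚ (p →L[ℝ] p) := .restrictScalars ℚ ℝ _
  have h : Commute (expUnit (t • E) : p →L[ℝ] p) E :=
    (((Commute.refl E).smul_left t).symm.exp_right).symm
  rw [h.eq, mul_assoc, Units.mul_inv, mul_one]

/-- `e^{-at} exp(tE)·γ` has zero derivative, because `E` commutes with its exponential. -/
theorem tensorAct_expUnit {E : p →L[ℝ] p} {γ : Tensors m r s p} {a : ℝ}
    (h : tensorRep E γ = a • γ) (t : ℝ) :
    tensorAct (expUnit (t • E)) γ = Real.exp (a * t) • γ := by
  have : CompleteSpace p := FiniteDimensional.complete ℝ p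
  have hd : ∀ t : ℝ, HasDerivAt
      (fun x => Real.exp (-(a * x)) • tensorAct (expUnit (x • E)) γ) 0 t := fun t => by
    have h1 := hasDerivAt_tensorAct (hasDerivAt_expUnit E t) γ
    rw [mul_assoc, Units.mul_inv, mul_one] at h1
    have h2 : tensorRep E (tensorAct (expUnit (t • E)) γ)
        = a • tensorAct (expUnit (t • E)) γ := by
      rw [← tensorAct_smul, ← h, tensorAct_tensorRep, expUnit_conj_self]
    have h3 : HasDerivAt (fun x => Real.exp (-(a * x))) (Real.exp (-(a * t)) * -(a * 1)) t :=
      ((hasDerivAt_id t).const_mul a).neg.exp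
    refine (h3.smul h1).congr_deriv ?_
    rw [h2, smul_smul, ← add_smul]
    ring_nf
    exact zero_smul ℝ _
  have hc := is_const_of_deriv_eq_zero (fun t => (hd t).differentiableAt)
    (fun t => (hd t).deriv) t 0
  simp only [mul_zero, neg_zero, Real.exp_zero, zero_smul, expUnit_zero, tensorAct_one,
    one_smul] at hc
  rw [← inv_smul_eq_iff₀ (Real.exp_ne_zero _), ← Real.exp_neg]
  exact hc

end Exponential

/-! ### The time change `s(t)` and the scale `c(t)`. -/

section Time

variable {α c : ℝ}

/-- Multiplying by `c` removes the case distinction: at `c = 0` both sides vanish. -/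
theorem mul_sFun (hα : α < 1) (c t : ℝ) :
    c * sFun α c t = Real.log ((1 - α) * c * t + 1) / (1 - α) := by
  have h1 : 1 - α ≠ 0 := by linarith
  by_cases hc : c = 0
  · simp [hc]
  · rw [sFun, if_neg hc]
    field_simp

theorem cFun_eq_exp (hα : α < 1) {t : ℝ} (ht : t ∈ timeInterval α c) :
    cFun α c t = Real.exp (c * sFun α c t) := by
  rw [cFun, Real.rpow_def_of_pos ht, mul_sFun hα, mul_one_div]

theorem hasDerivAt_sFun (hα : α < 1) {t : ℝ} (ht : t ∈ timeInterval α c) :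
    HasDerivAt (sFun α c) ((1 - α) * c * t + 1)⁻¹ t := by
  have h1 : 1 - α ≠ 0 := by linarith
  by_cases hc : c = 0
  · have h : sFun α c = id := by
      funext x
      simp [sFun, hc]
    rw [h]
    simpa [hc] using hasDerivAt_id t
  · have h : sFun α c = fun x => Real.log ((1 - α) * c * x + 1) / ((1 - α) * c) := by
      funext x
      simp [sFun, hc]
    rw [h]
    have hy : (1 - α) * c * t + 1 ≠ 0 := ne_of_gt ht
    refine ((((((hasDerivAt_id t).const_mul ((1 - α) * c)).add_const 1).log hy).div_const
      ((1 - α) * c))).congr_deriv ?_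
    simp only [id]
    field_simp

theorem isOpen_timeInterval (α c : ℝ) : IsOpen (timeInterval α c) :=
  isOpen_lt continuous_const (by fun_prop)

theorem convex_timeInterval (α c : ℝ) : Convex ℝ (timeInterval α c) := by
  intro x hx y hy a b ha hb hab
  simp only [timeInterval, Set.mem_ofPred_eq, smul_eq_mul] at *
  have : (1 - α) * c * (a * x + b * y) + 1
      = a * ((1 - α) * c * x + 1) + b * ((1 - α) * c * y + 1) := by
    linear_combination (-1 : ℝ) * hab
  rw [this]
  rcases ha.eq_or_lt with rfl | ha'
  · simp only [zero_add] at hab; subst hab; simpa using hy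
  · have := mul_pos ha' hx
    have := mul_nonneg hb hy.le
    linarith

theorem zero_mem_timeInterval (α c : ℝ) : (0 : ℝ) ∈ timeInterval α c := by
  simp [timeInterval]

end Time

/-! ### The soliton curve solves the bracket flow. -/

section Soliton

variable {k p : Type*} [NormedAddCommGroup k] [NormedSpace ℝ k]
  [NormedAddCommGroup p] [NormedSpace ℝ p] [FiniteDimensional ℝ p] {m r s : ℕ}

/-- The rescaled one-parameter group `e^{τA}` is the one-parameter group of `A - (c/(s-r)) I`. -/
theorem bracketScale_expUnit {x a τ : ℝ} (hx : x = Real.exp (τ * a)) (A : p →L[ℝ] p)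
    (μ : Bilin k p) :
    bracketScale x (bracketAct 1 (expUnit (τ • A)) μ)
      = bracketAct 1 (expUnit (τ • (A - a • (1 : p →L[ℝ] p)))) μ := by
  subst hx
  refine bracketScale_bracketAct _ _ ?_ ?_ μ
  · rw [expUnit_val, expUnit_val, ← Real.exp_neg, ← exp_add_smul_one]
    congr 1
    module
  · rw [expUnit_inv_val, expUnit_inv_val, ← exp_add_smul_one]
    congr 1
    module

/-- The scalar factors of the exponential and its inverse cancel. This replaces a conjugator that
only rescales `γ` by one that fixes it when `θ(A)γ = 0`. -/
theorem expUnit_conj_sub_smul_one (a τ : ℝ) (A B : p →L[ℝ] p) :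
    (expUnit (τ • (A - a • (1 : p →L[ℝ] p))) : p →L[ℝ] p) * B
      * (((expUnit (τ • (A - a • (1 : p →L[ℝ] p))))⁻¹ : (p →L[ℝ] p)ˣ) : p →L[ℝ] p)
      = (expUnit (τ • A) : p →L[ℝ] p) * B
      * (((expUnit (τ • A))⁻¹ : (p →L[ℝ] p)ˣ) : p →L[ℝ] p) := by
  have h1 : τ • (A - a • (1 : p →L[ℝ] p)) = τ • A + (-(τ * a)) • (1 : p →L[ℝ] p) := by module
  have h2 : -(τ • A + (-(τ * a)) • (1 : p →L[ℝ] p)) = -(τ • A) + (τ * a) • (1 : p →L[ℝ] p) := by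
    module
  rw [expUnit_val, expUnit_inv_val, h1, h2, exp_add_smul_one, exp_add_smul_one, smul_mul_assoc,
    smul_mul_assoc, mul_smul_comm, smul_smul, ← Real.exp_add, neg_add_cancel, Real.exp_zero,
    one_smul]
  rfl

variable (P : PreferredDirection k p m r s) {γ : Tensors m r s p} {𝔮 : Submodule ℝ (p →L[ℝ] p)}

theorem soliton_isBracketFlowSolution (hrs : r ≠ s) (h𝔮 : IsInvariantComplement γ 𝔮)
    (hI : (1 : p →L[ℝ] p) ∈ 𝔮) {μ : Bilin k p} {c : ℝ} {A B : p →L[ℝ] p}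
    (hmem : (μ, γ) ∈ P.Γ) (hder : bracketRep (diagP k (A + B)) μ = 0)
    (hq : P.q μ γ = c • γ + tensorRep (A + B) γ) (hA : tensorRep A γ = 0) (hB : B ∈ 𝔮)
    {ν : ℝ → Bilin k p}
    (hν : ∀ t ∈ timeInterval P.α c, ν t
      = bracketAct 1 (expUnit (sFun P.α c t • (A - (c / ((s : ℝ) - r)) • (1 : p →L[ℝ] p)))) μ) :
    IsBracketFlowSolution P γ 𝔮 ν (timeInterval P.α c) := by
  have : CompleteSpace p := FiniteDimensional.complete ℝ p
  have hsr : (s : ℝ) - r ≠ 0 := sub_ne_zero.2 (by exact_mod_cast hrs.symm)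
  set a : ℝ := c / ((s : ℝ) - r)
  set E : p →L[ℝ] p := A - a • (1 : p →L[ℝ] p)
  set Q₀ : p →L[ℝ] p := B + a • (1 : p →L[ℝ] p)
  set u : ℝ → (p →L[ℝ] p)ˣ := fun t => expUnit (sFun P.α c t • E)
  have haγ : tensorRep (a • (1 : p →L[ℝ] p)) γ = c • γ := by
    rw [tensorRep_smul, tensorRep_one, smul_smul, div_mul_cancel₀ _ hsr]
  have hEγ : tensorRep E γ = (-c) • γ := by
    rw [tensorRep_sub, hA, haγ, zero_sub, neg_smul]
  have hQ₀γ : tensorRep Q₀ γ = P.q μ γ := by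
    rw [hq, tensorRep_add, tensorRep_add, haγ, hA, zero_add, add_comm]
  have hQ₀ : Q₀ ∈ 𝔮 := 𝔮.add_mem hB (𝔮.smul_mem a hI)
  have hud : ∀ t ∈ timeInterval P.α c, HasDerivAt (fun x => (u x : p →L[ℝ] p))
      (((1 - P.α) * c * t + 1)⁻¹ • (E * (u t : p →L[ℝ] p))) t := fun t ht =>
    (hasDerivAt_expUnit E _).scomp t (hasDerivAt_sFun P.α_lt_one ht)
  -- The scalar is `s'(t)`; it comes both from the chain rule and from the scaling of `q`.
  refine ⟨fun t => ((1 - P.α) * c * t + 1)⁻¹ •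
    ((u t : p →L[ℝ] p) * Q₀ * (((u t)⁻¹ : (p →L[ℝ] p)ˣ) : p →L[ℝ] p)), ?_, fun t ht => ?_⟩
  · intro t ht
    have h1 : ContinuousAt (fun t => ((1 - P.α) * c * t + 1)⁻¹) t :=
      ContinuousAt.inv₀ (by fun_prop) (ne_of_gt ht)
    have h2 := ((hud t ht).continuousAt.mul (continuousAt_const (y := Q₀))).mul
      (hasDerivAt_units_inv (hud t ht)).continuousAt
    exact (h1.smul h2).continuousWithinAt
  have hy : 0 < (1 - P.α) * c * t + 1 := ht
  have hact : tensorAct (u t) γ = Real.exp (-c * sFun P.α c t) • γ := tensorAct_expUnit hEγ _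
  have hγ : Real.exp (c * sFun P.α c t) • tensorAct (u t) γ = γ := by
    rw [hact, smul_smul, ← Real.exp_add, neg_mul, add_neg_cancel, Real.exp_zero, one_smul]
  have hmem' := P.act_mem hmem 1 (u t)
  -- Write `γ` as `e^{cs}(u·γ)`: scaling contributes `e^{αcs}`, and `u·γ = e^{-cs}γ` the rest. The
  -- exponent `(α-1)cs` is `-log((1-α)ct+1)`.
  have hqt : P.q (bracketAct 1 (u t) μ) γ = ((1 - P.α) * c * t + 1)⁻¹ •
      tensorRep ((u t : p →L[ℝ] p) * Q₀ * (((u t)⁻¹ : (p →L[ℝ] p)ˣ) : p →L[ℝ] p)) γ := by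
    conv_lhs => rw [← hγ]
    rw [P.scaling hmem' _ (Real.exp_pos _), P.equivariant hmem, ← hQ₀γ, tensorAct_tensorRep, hact,
      tensorRep_smul_right, smul_smul, ← Real.exp_mul, ← Real.exp_add]
    congr 1
    have h1 : 1 - P.α ≠ 0 := by linarith [P.α_lt_one]
    have h2 : c * sFun P.α c t * P.α + -c * sFun P.α c t
        = -Real.log ((1 - P.α) * c * t + 1) := by
      have h3 := mul_sFun P.α_lt_one c t
      rw [eq_div_iff h1] at h3
      linear_combination -h3
    rw [h2, Real.exp_neg, Real.exp_log hy]
  refine ⟨?_, 𝔮.smul_mem _ ?_, ?_, ?_⟩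
  · have := P.smul_mem hmem' _ (Real.exp_pos (c * sFun P.α c t))
    rwa [hγ, ← hν t ht] at this
  · rw [expUnit_conj_sub_smul_one]
    refine h𝔮.conj_mem _ ?_ _ hQ₀
    have h0 : tensorRep A γ = (0 : ℝ) • γ := by rw [hA, zero_smul]
    rw [tensorAct_expUnit h0, zero_mul, Real.exp_zero, one_smul]
  · rw [tensorRep_smul, hν t ht, hqt]
  · have heq : ν =ᶠ[𝓝 t] fun x => bracketAct 1 (u x) μ :=
      Filter.eventually_of_mem ((isOpen_timeInterval P.α c).mem_nhds ht) hν
    refine HasDerivAt.congr_of_eventuallyEq ?_ heq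
    refine (hasDerivAt_bracketAct (hud t ht) (hasDerivAt_const t μ)).congr_deriv ?_
    rw [bracketAct_one_zero, hν t ht, smul_mul_assoc, mul_assoc E, Units.mul_inv, mul_one,
      bracketRep_diagP_smul, bracketRep_diagP_smul]
    -- Since `E` equals its conjugate by `u`, the sum is `u·θ(diag(0, E + Q₀))μ`, which vanishes by
    -- the derivation property.
    have hsum : bracketRep (diagP k E) (bracketAct 1 (u t) μ)
        + bracketRep (diagP k ((u t : p →L[ℝ] p) * Q₀
          * (((u t)⁻¹ : (p →L[ℝ] p)ˣ) : p →L[ℝ] p))) (bracketAct 1 (u t) μ) = 0 := by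
      have hE : (u t : p →L[ℝ] p) * E * (((u t)⁻¹ : (p →L[ℝ] p)ˣ) : p →L[ℝ] p) = E :=
        expUnit_conj_self E _
      conv_lhs => arg 1; rw [← hE]
      rw [← bracketRep_diagP_add, ← add_mul, ← mul_add,
        show E + Q₀ = A + B by simp only [E, Q₀]; abel, ← bracketAct_bracketRep, hder,
        bracketAct_one_zero]
    rw [eq_neg_of_add_eq_zero_left (G := Bilin k p) hsum]
    refine bilin_ext fun X Y => ?_
    simp
    rfl

end Soliton

end HomFlow

/-! ### The proposition, from existence and uniqueness. -/

theorem proposition6p2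
    {k p : Type*} [NormedAddCommGroup k] [NormedSpace ℝ k] [FiniteDimensional ℝ k]
    [NormedAddCommGroup p] [NormedSpace ℝ p] [FiniteDimensional ℝ p]
    (m r s : ℕ) (hrs : r ≠ s)
    (P : HomFlow.PreferredDirection k p m r s)
    (γ : HomFlow.Tensors m r s p)
    (𝔮 : Submodule ℝ (p →L[ℝ] p)) (h𝔮 : HomFlow.IsInvariantComplement γ 𝔮)
    (hI : (1 : p →L[ℝ] p) ∈ 𝔮)
    (μ : HomFlow.Bilin k p) (c : ℝ) (D : (k × p) →L[ℝ] (k × p))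
    (hsol : HomFlow.IsSemiAlgebraicSoliton P μ γ c D)
    (hD : D = HomFlow.diagP k (HomFlow.pBlock D))
    (A : p →L[ℝ] p)
    (hA : A = (HomFlow.stabilizerAlgebra γ).projection 𝔮 h𝔮.isCompl (HomFlow.pBlock D))
    (μt : ℝ → HomFlow.Bilin k p)
    (hμt : ∀ t, μt t = HomFlow.bracketScale (HomFlow.cFun P.α c t ^ (1 / ((s : ℝ) - (r : ℝ))))
      (HomFlow.bracketAct 1 (HomFlow.expUnit (HomFlow.sFun P.α c t • A)) μ)) :
    μt 0 = μ ∧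
    HomFlow.IsBracketFlowSolution P γ 𝔮 μt (HomFlow.timeInterval P.α c) ∧
    ∀ (J : Set ℝ) (ν : ℝ → HomFlow.Bilin k p), IsOpen J → J.OrdConnected → 0 ∈ J →
      HomFlow.IsBracketFlowSolution P γ 𝔮 ν J → ν 0 = μ →
      ∀ t ∈ J ∩ HomFlow.timeInterval P.α c, ν t = μt t := by
  open HomFlow in
  have : CompleteSpace p := FiniteDimensional.complete ℝ p
  have hμt' : ∀ t ∈ timeInterval P.α c, μt t = bracketAct 1 (expUnit
      (sFun P.α c t • (A - (c / ((s : ℝ) - r)) • (1 : p →L[ℝ] p)))) μ := fun t ht => by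
    rw [hμt, cFun_eq_exp P.α_lt_one ht, ← Real.exp_mul]
    exact bracketScale_expUnit (congrArg Real.exp (by ring)) A μ
  have h0 : μt 0 = μ := by
    rw [hμt' 0 (zero_mem_timeInterval _ _)]
    have hs0 : sFun P.α c 0 = 0 := by simp [sFun]
    rw [hs0, zero_smul, expUnit_zero, bracketAct_one_one]
  have hAmem : A ∈ stabilizerAlgebra γ := by
    rw [hA]
    exact Submodule.projection_apply_mem _ _
  have hB : pBlock D - A ∈ 𝔮 := by
    rw [hA]
    exact Submodule.sub_projection_mem _ _
  have hAB : A + (pBlock D - A) = pBlock D := by abel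
  have hflow : IsBracketFlowSolution P γ 𝔮 μt (timeInterval P.α c) :=
    soliton_isBracketFlowSolution P hrs h𝔮 hI hsol.mem
      (by rw [hAB, ← hD]; exact hsol.isDerivation.bracketRep_eq_zero)
      (by rw [hAB]; exact hsol.eq) hAmem hB hμt'
  refine ⟨h0, hflow, fun J ν hJ hJc hJ0 hν hν0 => ?_⟩
  have hconn : (J ∩ timeInterval P.α c).OrdConnected :=
    hJc.inter (convex_timeInterval P.α c).ordConnected
  exact IsBracketFlowSolution.eqOn P h𝔮 hJ (isOpen_timeInterval _ _) hconn.isPreconnected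
    ⟨hJ0, zero_mem_timeInterval _ _⟩ hν hflow (hν0.trans h0.symm)
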